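/- Expressions are terms of the untyped $\lambda$-calculus with named variables (names are strings): $e ::= \mathrm{Var}\,v \mid \mathrm{Lam}\,x\,e \mid \mathrm{App}\,e_1\,e_2$; $|e|$ is the number of nodes of $e$, and $e_1\not\equiv e_2$ means that $e_1,e_2$ are not $\alpha$-equivalent. Let $b\ge 1$, $\mathbb H=\{0,1\}^b$, $\mathbb H_\bot=\mathbb H\cup\{\bot\}$, and let $\oplus$ be bitwise XOR. A *hashing instantiation* consists of constants $s_0,p_0\in\mathbb H$ and functions $$s_L:\mathbb N\times\mathbb H_\bot\times\mathbb H\to\mathbb H,\quad s_A:\mathbb N\times\{0,1\}\times\mathbb H^2\to\mathbb H,\quad p_J:\mathbb N^2\times\mathbb H_\bot\times\mathbb H\to\mathbb H,$$ $$\eta:\mathrm{Names}\times\mathbb H\to\mathbb H,\quad c:\mathbb H^2\to\mathbb H .$$ Given an instantiation, $\mathrm{summariseExpr}(e)=(\sigma,m)$ is defined by recursion on $e$. Here $\sigma$ is the structure of $e$, represented by a hash code together with a size and a depth. The variable map $m$ is a finite map from the free variables of $e$ to position trees, each represented by a hash code together with a size. Along with $m$ one maintains $\mathrm{hash}(m)\in\mathbb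 H$: whenever an entry $(v,p)$ is added to $m$ or removed from it, $\mathrm{hash}(m)$ is replaced by $\mathrm{hash}(m)\oplus\eta(v,\mathrm{hash}(p))$ (replacing the value at $v$ does both), so that $\mathrm{hash}(m)=\bigoplus_{(v,p)\in m}\eta(v,\mathrm{hash}(p))$. * $\mathrm{Var}\,v$: $\sigma$ has hash $s_0$, size $1$ and depth $1$; $m=\{v\mapsto p\}$, where $p$ has hash $p_0$ and size $1$. * $\mathrm{Lam}\,x\,e'$, with $\mathrm{summariseExpr}(e')=(\sigma',m')$: $m$ is $m'$ with $x$ removed; $\sigma$ has size $n=\mathrm{size}(\sigma')+1$, depth $\mathrm{depth}(\sigma')+1$ and hash $s_L(n,\mathrm{hash}(m'(x)),\mathrm{hash}(\sigma'))$, with $\bot$ in the second place if $x$ is not in $m'$. * $\mathrm{App}\,e_1\,e_2$, with $\mathrm{summariseExpr}(e_i)=(\sigma_i,m_i)$: let $\ell=1$ if $m_1$ has strictly more entries than $m_2$, and $\ell=0$ otherwise; the bigger map is $m_1$ if $\ell=1$ and $m_2$ if $\ell=0$, and the smaller map is the other one. Then $\sigma$ has size $n=\mathrm{size}(\sigma_1)+\mathrm{size}(\sigma_2)+1$,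 depth $t=\max(\mathrm{depth}(\sigma_1),\mathrm{depth}(\sigma_2))+1$ and hash $s_A(n,\ell,\mathrm{hash}(\sigma_1),\mathrm{hash}(\sigma_2))$. The map $m$ is obtained from the bigger map as follows: for each entry $(v,p)$ of the smaller map, the value at $v$ becomes the position tree of size $k=\mathrm{size}(q)+\mathrm{size}(p)+1$ and hash $p_J(k,t,\mathrm{hash}(q),\mathrm{hash}(p))$, where $q$ is the value at $v$ in the bigger map (if $v$ is not in the bigger map, $\mathrm{size}(q)$ is read as $0$ and $\mathrm{hash}(q)$ as $\bot$). Finally $\mathrm{hashESummary}(\sigma,m)=c(\mathrm{hash}(\sigma),\mathrm{hash}(m))$ and $h(e)=\mathrm{hashESummary}(\mathrm{summariseExpr}(e))$. **Theorem.** For every $b\ge1$ there is a random hashing instantiation (defined on some probability space, and not depending on any expression) such that $h(e)$ is a random variable for every expression $e$, and for all expressions $e_1,e_2$ with $e_1\not\equiv e_2$, $$P\bigl(h(e_1)=h(e_2)\bigr)\le 5\,\frac{|e_1|+|e_2|}{2^b}.$$ -/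

import Mathlib

namespace AlphaHash

/-! ### Expressions and α-equivalence -/

abbrev Name := String

/-- Expressions of the untyped λ-calculus, with named variables. -/
inductive Expression where
  | var (v : Name)
  | lam (x : Name) (e : Expression)
  | app (e₁ e₂ : Expression)

/-- The number of nodes `|e|` of an expression. -/
def Expression.size : Expression → ℕ
  | .var _ => 1
  | .lam _ e => e.size + 1
  | .app e₁ e₂ => e₁.size + e₂.size + 1

/-- The variable occurrences `x` (on the left) and `y` (on the right) match under the list `Γ` of
pairs of enclosing binders, innermost pair first: either they refer to the same pair of binders, or
both are free and they are the same name. -/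
def VarMatch : List (Name × Name) → Name → Name → Prop
  | [], x, y => x = y
  | (a, c) :: Γ, x, y => (x = a ∧ y = c) ∨ (x ≠ a ∧ y ≠ c ∧ VarMatch Γ x y)

/-- α-equivalence of two expressions under a list of pairs of enclosing binders. -/
def AlphaEquivUnder : List (Name × Name) → Expression → Expression → Prop
  | Γ, .var x, .var y => VarMatch Γ x y
  | Γ, .lam x e, .lam y e' => AlphaEquivUnder ((x, y) :: Γ) e e'
  | Γ, .app e₁ e₂, .app e₁' e₂' => AlphaEquivUnder Γ e₁ e₁' ∧ AlphaEquivUnder Γ e₂ e₂'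
  | _, _, _ => False

/-- α-equivalence: equality up to renaming of the λ-bound variables. -/
def AlphaEquiv (e₁ e₂ : Expression) : Prop := AlphaEquivUnder [] e₁ e₂

/-! ### Hash codes, hashing functions and combiners -/

/-- The set `{0,1}^b` of hash codes of width `b`. -/
abbrev HashCode (b : ℕ) := Fin b → Bool

/-- Bitwise exclusive or. -/
def HashCode.xor {b : ℕ} (g h : HashCode b) : HashCode b := fun i => Bool.xor (g i) (h i)

/-- A choice of all the hashing functions and combiners with which the algorithm is instantiated.
Sub-objects enter a combiner only through their hash codes; a combiner also sees the size (the
number of constructor calls) of the object that is being built. -/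
structure Hashing (b : ℕ) where
  /-- the hash code of an anonymous variable -/
  sVar : HashCode b
  /-- combiner for a lambda: size, position tree of the bound variable (if it occurs), body -/
  sLam : (size : ℕ) → Option (HashCode b) → HashCode b → HashCode b
  /-- combiner for an application: size, "left has more free variables" flag, left, right -/
  sApp : (size : ℕ) → Bool → HashCode b → HashCode b → HashCode b
  /-- the hash code of the one-point position tree -/
  ptHere : HashCode b
  /-- combiner for joined position trees: size, structure tag, tree from the bigger map (if any),
  tree from the smaller map -/
  ptJoin : (size : ℕ) → (tag : ℕ) → Option (HashCode b) → HashCode b → HashCode b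
  /-- hash of a variable map entry -/
  entry : Name → HashCode b → HashCode b
  /-- combiner for the hash of the structure and the hash of the variable map -/
  summary : HashCode b → HashCode b → HashCode b

/-! ### Structures, position trees and variable maps, represented by their hash codes -/

/-- A structure, represented by its hash code; its number of constructors and its depth are
computed and stored when it is built. -/
structure Structure (b : ℕ) where
  hash : HashCode b
  size : ℕ
  depth : ℕ

/-- The tag of a structure: larger than the tag of each of its proper sub-structures. -/
def structureTag {b : ℕ} (s : Structure b) : ℕ := s.depth

/-- A position tree, represented by its hash code; its number of constructors is stored. -/
structure PosTree (b : ℕ) where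
  hash : HashCode b
  size : ℕ

/-- A variable map: a finite map from names to position trees, together with its hash. -/
structure VarMap (b : ℕ) where
  entries : AList (fun _ : Name => PosTree b)
  hash : HashCode b

structure ESummary (b : ℕ) where
  str : Structure b
  vm : VarMap b

section Algorithm

variable {b : ℕ} (H : Hashing b)

def mkSVar : Structure b := ⟨H.sVar, 1, 1⟩

def mkSLam (p : Option (PosTree b)) (s : Structure b) : Structure b :=
  ⟨H.sLam (s.size + 1) (p.map PosTree.hash) s.hash, s.size + 1, s.depth + 1⟩

def mkSApp (leftBigger : Bool) (s₁ s₂ : Structure b) : Structure b :=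
  ⟨H.sApp (s₁.size + s₂.size + 1) leftBigger s₁.hash s₂.hash,
    s₁.size + s₂.size + 1, max s₁.depth s₂.depth + 1⟩

def mkPTHere : PosTree b := ⟨H.ptHere, 1⟩

/-- `big` is the child from the bigger map (if there is one), `small` that from the smaller map. -/
def mkPTJoin (tag : ℕ) (big : Option (PosTree b)) (small : PosTree b) : PosTree b :=
  ⟨H.ptJoin ((big.map PosTree.size).getD 0 + small.size + 1) tag (big.map PosTree.hash) small.hash,
    (big.map PosTree.size).getD 0 + small.size + 1⟩

def entryHash (key : Name) (pos : PosTree b) : HashCode b := H.entry key pos.hash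

def singletonVM (key : Name) (pos : PosTree b) : VarMap b :=
  ⟨AList.singleton key pos, entryHash H key pos⟩

/-- Alter the value to which `key` is mapped, and update the hash of the map. -/
def alterVM (f : Option (PosTree b) → PosTree b) (key : Name) (m : VarMap b) : VarMap b :=
  match m.entries.lookup key with
  | some oldPt =>
      ⟨m.entries.insert key (f (some oldPt)),
        (m.hash.xor (entryHash H key oldPt)).xor (entryHash H key (f (some oldPt)))⟩
  | none =>
      ⟨m.entries.insert key (f none), m.hash.xor (entryHash H key (f none))⟩

/-- Remove `key` from the map, and return what it was mapped to (if anything). -/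
def removeFromVM (key : Name) (m : VarMap b) : VarMap b × Option (PosTree b) :=
  match m.entries.lookup key with
  | some pt => (⟨m.entries.erase key, m.hash.xor (entryHash H key pt)⟩, some pt)
  | none => (m, none)

/-- Does the first map have more entries than the second? -/
def isBiggerThanVM (m₁ m₂ : VarMap b) : Bool :=
  decide (m₂.entries.entries.length < m₁.entries.entries.length)

/-- Add all entries of the smaller map, one by one, to the bigger map. -/
def joinVM (tag : ℕ) (big small : VarMap b) : VarMap b :=
  small.entries.entries.foldr
    (fun kv m => alterVM H (fun mp => mkPTJoin H tag mp kv.2) kv.1 m) big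

/-- The e-summary of an expression, with all hashes computed compositionally. -/
def summariseExpr : Expression → ESummary b
  | .var v => ⟨mkSVar H, singletonVM H v (mkPTHere H)⟩
  | .lam x e =>
      let s := summariseExpr e
      let r := removeFromVM H x s.vm
      ⟨mkSLam H r.2 s.str, r.1⟩
  | .app e₁ e₂ =>
      let s₁ := summariseExpr e₁
      let s₂ := summariseExpr e₂
      let leftBigger := isBiggerThanVM s₁.vm s₂.vm
      let str := mkSApp H leftBigger s₁.str s₂.str
      let big := if leftBigger then s₁.vm else s₂.vm
      let small := if leftBigger then s₂.vm else s₁.vm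
      ⟨str, joinVM H (structureTag str) big small⟩

def hashESummary (s : ESummary b) : HashCode b := H.summary s.str.hash s.vm.hash

/-- The hash of an expression. -/
def hashExpr (e : Expression) : HashCode b := hashESummary H (summariseExpr H e)

end Algorithm

end AlphaHash

/-! Every expression has a symbolic summary, namely a `skeleton` and a map `pos` from names to
position trees, which the algorithm evaluates under whatever combiners it is given. Equal symbolic
summaries force α-equivalence (`alphaEquiv_of_skeleton_eq`): the tag of a join exceeds every tag in
the maps being joined, so a join of maps can be undone.

Take all combiner values independent and uniform. Their arguments are themselves random, but the
size arguments and the kinds of combiner order the queries so that each is determined by answers of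
smaller rank. Hence two distinct queries receive the same answer with probability at most `2^-b`
(`measure_answer_collision_le`). Following one differing component at a time bounds collisions of
position trees by their size and of skeletons by the size of the expression. For maps, an entry on
which they differ is, barring a collision of position trees, a fresh uniform summand of the XOR
(`measure_mapHash_collision_le_of_some`). With one more `2^-b` for the final combiner, the total is
at most `(|e₁| + |e₂| + 2) / 2^b`, which is below the claimed bound. -/

namespace AlphaHash

/-! ### Symbolic summaries -/

/-- Position trees before hashing: `graft` is a join without a child from the bigger map. -/
inductive PTree where
  | here
  | graft (tag : ℕ) (small : PTree)
  | join (tag : ℕ) (big small : PTree)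

namespace PTree

def size : PTree → ℕ
  | here => 1
  | graft _ p => p.size + 1
  | join _ q p => q.size + p.size + 1

def tag : PTree → ℕ
  | here => 0
  | graft t _ => t
  | join t _ _ => t

def ofBig : PTree → Option PTree
  | here => none
  | graft _ _ => none
  | join _ q _ => some q

def ofSmall : PTree → Option PTree
  | here => none
  | graft _ p => some p
  | join _ _ p => some p

/-- The value at a name of the join of two maps, in terms of its values there. -/
def combine (t : ℕ) : Option PTree → Option PTree → Option PTree
  | big, none => big
  | none, some p => some (graft t p)
  | some q, some p => some (join t q p)

/-- With `splitSmall`, this inverts `combine t` when all tags in the bigger map are less than `t`: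
the root then carries tag `t` exactly when the name occurs in the smaller map. -/
def splitBig (t : ℕ) : Option PTree → Option PTree
  | none => none
  | some p => if p.tag = t then p.ofBig else some p

def splitSmall (t : ℕ) : Option PTree → Option PTree
  | none => none
  | some p => if p.tag = t then p.ofSmall else none

theorem splitBig_combine {t : ℕ} {q : Option PTree} (hq : ∀ r, q = some r → r.tag < t)
    (p : Option PTree) : splitBig t (combine t q p) = q := by
  rcases q with _ | q <;> rcases p with _ | p
  · rfl
  · exact if_pos rfl
  · exact if_neg (hq q rfl).ne
  · exact if_pos rfl

theorem splitSmall_combine {t : ℕ} {q : Option PTree} (hq : ∀ r, q = some r → r.tag < t)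
    (p : Option PTree) : splitSmall t (combine t q p) = p := by
  rcases q with _ | q <;> rcases p with _ | p
  · rfl
  · exact if_pos rfl
  · exact if_neg (hq q rfl).ne
  · exact if_pos rfl

end PTree

/-- Structures before hashing. -/
inductive Skeleton where
  | var
  | lamUnused (s : Skeleton)
  | lamUsed (p : PTree) (s : Skeleton)
  | app (leftBigger : Bool) (s₁ s₂ : Skeleton)

namespace Skeleton

def size : Skeleton → ℕ
  | var => 1
  | lamUnused s => s.size + 1
  | lamUsed _ s => s.size + 1
  | app _ s₁ s₂ => s₁.size + s₂.size + 1

def depth : Skeleton → ℕ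
  | var => 1
  | lamUnused s => s.depth + 1
  | lamUsed _ s => s.depth + 1
  | app _ s₁ s₂ => max s₁.depth s₂.depth + 1

def ofLam : Option PTree → Skeleton → Skeleton
  | none, s => lamUnused s
  | some p, s => lamUsed p s

theorem ofLam_inj {o o' : Option PTree} {s s' : Skeleton} (h : ofLam o s = ofLam o' s') :
    o = o' ∧ s = s' := by
  rcases o with _ | p <;> rcases o' with _ | p' <;> simp_all [ofLam]

end Skeleton

namespace Expression

def free : Expression → Finset Name
  | var v => {v}
  | lam x e => e.free.erase x
  | app e₁ e₂ => e₁.free ∪ e₂.free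

def depth : Expression → ℕ
  | var _ => 1
  | lam _ e => e.depth + 1
  | app e₁ e₂ => max e₁.depth e₂.depth + 1

def leftBigger (e₁ e₂ : Expression) : Bool := decide (e₂.free.card < e₁.free.card)

/-- The position tree of a free variable. -/
def pos : Expression → Name → Option PTree
  | var v, u => if u = v then some .here else none
  | lam x e, u => if u = x then none else e.pos u
  | app e₁ e₂, u =>
      PTree.combine (max e₁.depth e₂.depth + 1)
        (if leftBigger e₁ e₂ then e₁.pos u else e₂.pos u)
        (if leftBigger e₁ e₂ then e₂.pos u else e₁.pos u)

def skeleton : Expression → Skeleton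
  | var _ => .var
  | lam x e => .ofLam (e.pos x) e.skeleton
  | app e₁ e₂ => .app (leftBigger e₁ e₂) e₁.skeleton e₂.skeleton

theorem skeleton_depth (e : Expression) : e.skeleton.depth = e.depth := by
  induction e with
  | var v => rfl
  | lam x e ih => cases h : e.pos x <;> simp [skeleton, h, Skeleton.ofLam, Skeleton.depth, depth, ih]
  | app e₁ e₂ ih₁ ih₂ => simp [skeleton, Skeleton.depth, depth, ih₁, ih₂]

/-- A root tag is the depth of the subexpression where the tree was last joined. An application uses
a tag larger than both depths below it, so its tag is new to both maps. -/
theorem tag_le_depth {e : Expression} {u : Name} {p : PTree} (h : e.pos u = some p) :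
    p.tag ≤ e.depth := by
  induction e generalizing p with
  | var v =>
    simp only [pos] at h
    split_ifs at h
    cases h
    simp [PTree.tag]
  | lam x e ih =>
    simp only [pos] at h
    split_ifs at h
    exact (ih h).trans (Nat.le_succ _)
  | app e₁ e₂ ih₁ ih₂ =>
    simp only [pos] at h
    cases h₁ : e₁.pos u <;> cases h₂ : e₂.pos u <;> cases hl : leftBigger e₁ e₂ <;>
      simp only [h₁, h₂, hl, PTree.combine, if_true, Bool.false_eq_true, if_false,
        Option.some.injEq, reduceCtorEq] at h <;> subst h <;> simp only [depth, PTree.tag, le_refl] <;>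
      first
        | exact (ih₁ h₁).trans (by omega)
        | exact (ih₂ h₂).trans (by omega)

theorem pos_size_le {e : Expression} {u : Name} {p : PTree} (h : e.pos u = some p) :
    p.size ≤ e.size := by
  induction e generalizing p with
  | var v =>
    simp only [pos] at h
    split_ifs at h
    cases h
    simp [PTree.size, size]
  | lam x e ih =>
    simp only [pos] at h
    split_ifs at h
    exact (ih h).trans (Nat.le_succ _)
  | app e₁ e₂ ih₁ ih₂ =>
    simp only [pos] at h
    cases h₁ : e₁.pos u <;> cases h₂ : e₂.pos u <;> cases hl : leftBigger e₁ e₂ <;>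
      simp only [h₁, h₂, hl, PTree.combine, if_true, Bool.false_eq_true, if_false,
        Option.some.injEq, reduceCtorEq] at h <;> subst h <;> simp only [size, PTree.size] <;>
      first
        | (have := ih₁ h₁; have := ih₂ h₂; omega)
        | (have := ih₁ h₁; omega)
        | (have := ih₂ h₂; omega)

theorem mem_free {e : Expression} {u : Name} : u ∈ e.free ↔ e.pos u ≠ none := by
  induction e with
  | var v => simp [free, pos]
  | lam x e ih => by_cases h : u = x <;> simp [free, pos, h, ih]
  | app e₁ e₂ ih₁ ih₂ =>
    simp only [free, pos, Finset.mem_union, ih₁, ih₂]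
    cases e₁.pos u <;> cases e₂.pos u <;> cases leftBigger e₁ e₂ <;> simp [PTree.combine]

theorem splitBig_pos_app (e₁ e₂ : Expression) (u : Name) :
    PTree.splitBig (max e₁.depth e₂.depth + 1) ((app e₁ e₂).pos u) =
      if leftBigger e₁ e₂ then e₁.pos u else e₂.pos u := by
  refine PTree.splitBig_combine (fun r hr => ?_) _
  split_ifs at hr
  · exact Nat.lt_succ_of_le ((tag_le_depth hr).trans (le_max_left _ _))
  · exact Nat.lt_succ_of_le ((tag_le_depth hr).trans (le_max_right _ _))

theorem splitSmall_pos_app (e₁ e₂ : Expression) (u : Name) :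
    PTree.splitSmall (max e₁.depth e₂.depth + 1) ((app e₁ e₂).pos u) =
      if leftBigger e₁ e₂ then e₂.pos u else e₁.pos u := by
  refine PTree.splitSmall_combine (fun r hr => ?_) _
  split_ifs at hr
  · exact Nat.lt_succ_of_le ((tag_le_depth hr).trans (le_max_left _ _))
  · exact Nat.lt_succ_of_le ((tag_le_depth hr).trans (le_max_right _ _))

end Expression

/-! ### Symbolic summaries determine expressions up to α-equivalence -/

theorem varMatch_nil {u v : Name} : VarMatch [] u v ↔ u = v := Iff.rfl

/-- Two variable maps correspond under a list of pairs of binders. -/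
structure MapMatch (Γ : List (Name × Name)) (m m' : Name → Option PTree) : Prop where
  eq_of_varMatch : ∀ u v, VarMatch Γ u v → m u = m' v
  exists_varMatch : ∀ u, m u ≠ none → ∃ v, VarMatch Γ u v

open Expression in
theorem alphaEquivUnder_of_skeleton_eq {e e' : Expression} {Γ : List (Name × Name)}
    (hs : e.skeleton = e'.skeleton) (hm : MapMatch Γ e.pos e'.pos) : AlphaEquivUnder Γ e e' := by
  induction e generalizing e' Γ with
  | var v =>
    rcases e' with w | ⟨y, f⟩ | ⟨f₁, f₂⟩
    -- The partner of `v` must lie in the support of the other map, which is the single name `w`.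
    · obtain ⟨w', hw⟩ := hm.exists_varMatch v (by simp [pos])
      have h := hm.eq_of_varMatch v w' hw
      simp only [pos, if_true] at h
      split_ifs at h with hww
      exact hww ▸ hw
    · cases h : f.pos y <;> simp [skeleton, Skeleton.ofLam, h] at hs
    · simp [skeleton] at hs
  | lam x e ih =>
    rcases e' with w | ⟨y, f⟩ | ⟨f₁, f₂⟩
    · cases h : e.pos x <;> simp [skeleton, Skeleton.ofLam, h] at hs
    · obtain ⟨hp, hs'⟩ := Skeleton.ofLam_inj hs
      refine ih hs' ⟨?_, ?_⟩
      · rintro u v (⟨rfl, rfl⟩ | ⟨hu, hv, huv⟩)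
        · exact hp
        · simpa [pos, hu, hv] using hm.eq_of_varMatch u v huv
      · intro u hu
        by_cases hux : u = x
        · exact ⟨y, Or.inl ⟨hux, rfl⟩⟩
        · have hu' : (lam x e).pos u ≠ none := by simpa [pos, hux] using hu
          obtain ⟨v, huv⟩ := hm.exists_varMatch u hu'
          refine ⟨v, Or.inr ⟨hux, ?_, huv⟩⟩
          -- The partner of a free `u` cannot be the new binder: that binder has been removed from
          -- the right-hand map, while `u` is still present on the left.
          rintro rfl
          exact hu' (by simpa [pos] using hm.eq_of_varMatch u v huv)
    · cases h : e.pos x <;> simp [skeleton, Skeleton.ofLam, h] at hs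
  | app e₁ e₂ ih₁ ih₂ =>
    rcases e' with w | ⟨y, f⟩ | ⟨f₁, f₂⟩
    · simp [skeleton] at hs
    · cases h : f.pos y <;> simp [skeleton, Skeleton.ofLam, h] at hs
    · simp only [skeleton, Skeleton.app.injEq] at hs
      obtain ⟨hl, hs₁, hs₂⟩ := hs
      -- Equal skeletons give equal depths, so both sides split their maps at the same tag; the flag
      -- `hl` then says which half belongs to which child.
      have hd₁ : e₁.depth = f₁.depth := by rw [← skeleton_depth, hs₁, skeleton_depth]
      have hd₂ : e₂.depth = f₂.depth := by rw [← skeleton_depth, hs₂, skeleton_depth]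
      have key : ∀ u v, VarMatch Γ u v → e₁.pos u = f₁.pos v ∧ e₂.pos u = f₂.pos v := by
        intro u v huv
        have h := hm.eq_of_varMatch u v huv
        have hb := splitBig_pos_app e₁ e₂ u
        have hb' := splitSmall_pos_app e₁ e₂ u
        rw [h, hd₁, hd₂, hl] at hb hb'
        rw [splitBig_pos_app] at hb
        rw [splitSmall_pos_app] at hb'
        split_ifs at hb hb'
        · exact ⟨hb.symm, hb'.symm⟩
        · exact ⟨hb'.symm, hb.symm⟩
      have key' : ∀ u, u ∈ (app e₁ e₂).free → ∃ v, VarMatch Γ u v := fun u hu =>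
        hm.exists_varMatch u (mem_free.1 hu)
      exact ⟨ih₁ hs₁ ⟨fun u v h => (key u v h).1,
          fun u hu => key' u (Finset.mem_union_left _ (mem_free.2 hu))⟩,
        ih₂ hs₂ ⟨fun u v h => (key u v h).2,
          fun u hu => key' u (Finset.mem_union_right _ (mem_free.2 hu))⟩⟩

theorem alphaEquiv_of_skeleton_eq {e e' : Expression} (hs : e.skeleton = e'.skeleton)
    (hm : e.pos = e'.pos) : AlphaEquiv e e' :=
  alphaEquivUnder_of_skeleton_eq hs
    ⟨fun u v h => by rw [hm, varMatch_nil.1 h], fun u _ => ⟨u, rfl⟩⟩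

/-! ### The algorithm evaluates the symbolic summaries -/

theorem HashCode.xor_eq_add {b : ℕ} (g h : HashCode b) : g.xor h = g + h := rfl

theorem HashCode.add_self {b : ℕ} (g : HashCode b) : g + g = 0 :=
  funext fun i => Bool.xor_self (g i)

section Evaluation

variable {b : ℕ} (H : Hashing b)

def PTree.eval : PTree → PosTree b
  | .here => mkPTHere H
  | .graft t p => mkPTJoin H t none p.eval
  | .join t q p => mkPTJoin H t (some q.eval) p.eval

def Skeleton.eval : Skeleton → Structure b
  | .var => mkSVar H
  | .lamUnused s => mkSLam H none s.eval
  | .lamUsed p s => mkSLam H (some (p.eval H)) s.eval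
  | .app l s₁ s₂ => mkSApp H l s₁.eval s₂.eval

theorem PTree.eval_size (p : PTree) : (p.eval H).size = p.size := by
  induction p with
  | here => rfl
  | graft t p ih => simp [eval, mkPTJoin, size, ih]
  | join t q p ihq ihp => simp [eval, mkPTJoin, size, ihq, ihp]

theorem Skeleton.eval_size (s : Skeleton) : (s.eval H).size = s.size := by
  induction s with
  | var => rfl
  | lamUnused s ih => simp [eval, mkSLam, size, ih]
  | lamUsed p s ih => simp [eval, mkSLam, size, ih]
  | app l s₁ s₂ ih₁ ih₂ => simp [eval, mkSApp, size, ih₁, ih₂]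

theorem Skeleton.eval_depth (s : Skeleton) : (s.eval H).depth = s.depth := by
  induction s with
  | var => rfl
  | lamUnused s ih => simp [eval, mkSLam, depth, ih]
  | lamUsed p s ih => simp [eval, mkSLam, depth, ih]
  | app l s₁ s₂ ih₁ ih₂ => simp [eval, mkSApp, depth, ih₁, ih₂]

/-- The contribution of a name to the hash of a variable map. -/
def optEntryHash (v : Name) : Option (PosTree b) → HashCode b
  | none => 0
  | some p => entryHash H v p

/-- The stored hash of the variable map is the sum of the hashes of its entries. -/
def VarMap.Consistent (m : VarMap b) : Prop :=
  ∀ S : Finset Name, (∀ v, m.entries.lookup v ≠ none → v ∈ S) →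
    m.hash = ∑ v ∈ S, optEntryHash H v (m.entries.lookup v)

variable {H}

theorem alterVM_lookup (f : Option (PosTree b) → PosTree b) (k : Name) (m : VarMap b) (u : Name) :
    (alterVM H f k m).entries.lookup u =
      if u = k then some (f (m.entries.lookup k)) else m.entries.lookup u := by
  unfold alterVM
  split <;> rename_i h <;> split_ifs with hu
  · rw [hu, AList.lookup_insert, h]
  · exact AList.lookup_insert_ne hu
  · rw [hu, AList.lookup_insert, h]
  · exact AList.lookup_insert_ne hu

theorem alterVM_hash (f : Option (PosTree b) → PosTree b) (k : Name) (m : VarMap b) :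
    (alterVM H f k m).hash = m.hash + optEntryHash H k (m.entries.lookup k) +
      optEntryHash H k (some (f (m.entries.lookup k))) := by
  unfold alterVM
  split <;> rename_i h <;> simp [h, optEntryHash, HashCode.xor_eq_add]

theorem removeFromVM_lookup (k : Name) (m : VarMap b) (u : Name) :
    (removeFromVM H k m).1.entries.lookup u = if u = k then none else m.entries.lookup u := by
  unfold removeFromVM
  split <;> rename_i h <;> split_ifs with hu
  · rw [hu, AList.lookup_erase]
  · exact AList.lookup_erase_ne hu
  · rw [hu, h]
  · rfl

theorem removeFromVM_snd (k : Name) (m : VarMap b) :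
    (removeFromVM H k m).2 = m.entries.lookup k := by
  unfold removeFromVM
  split <;> rename_i h <;> exact h.symm

theorem removeFromVM_hash (k : Name) (m : VarMap b) :
    (removeFromVM H k m).1.hash = m.hash + optEntryHash H k (m.entries.lookup k) := by
  unfold removeFromVM
  split <;> rename_i h <;> simp [h, optEntryHash, HashCode.xor_eq_add]

/-- Changing a map at one name changes its hash by the old and the new entry. -/
theorem VarMap.Consistent.of_change {m m' : VarMap b} (hm : m.Consistent H) (k : Name)
    (hne : ∀ u, u ≠ k → m'.entries.lookup u = m.entries.lookup u)
    (hh : m'.hash = m.hash + optEntryHash H k (m.entries.lookup k) +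
      optEntryHash H k (m'.entries.lookup k)) : m'.Consistent H := by
  intro S hS
  -- `k` may lie outside `S` when it has been removed, so both sums are taken over `insert k S`.
  have h1 : m.hash = ∑ v ∈ insert k S, optEntryHash H v (m.entries.lookup v) := by
    refine hm _ fun v hv => ?_
    by_cases hvk : v = k
    · exact hvk ▸ Finset.mem_insert_self _ _
    · exact Finset.mem_insert_of_mem (hS v (by rwa [hne v hvk]))
  have h2 : ∑ v ∈ S, optEntryHash H v (m'.entries.lookup v) =
      ∑ v ∈ insert k S, optEntryHash H v (m'.entries.lookup v) := by
    refine Finset.sum_subset (Finset.subset_insert k S) fun v _ hv => ?_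
    have : m'.entries.lookup v = none := not_not.1 (mt (hS v) hv)
    rw [this, optEntryHash]
  rw [h2, hh, h1, ← Finset.add_sum_erase _ _ (Finset.mem_insert_self k S),
    ← Finset.add_sum_erase (insert k S) (fun v => optEntryHash H v (m'.entries.lookup v))
      (Finset.mem_insert_self k S)]
  rw [Finset.sum_congr rfl fun v hv => by rw [← hne v (Finset.ne_of_mem_erase hv)]]
  have hcancel : ∀ a s c : HashCode b, a + s + a + c = c + s := fun a s c => by
    rw [add_comm a s, add_assoc s a a, HashCode.add_self, add_zero, add_comm]
  exact hcancel _ _ _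

theorem VarMap.Consistent.alterVM {m : VarMap b} (hm : m.Consistent H)
    (f : Option (PosTree b) → PosTree b) (k : Name) : (alterVM H f k m).Consistent H :=
  hm.of_change k (fun u hu => by rw [alterVM_lookup, if_neg hu])
    (by rw [alterVM_hash, alterVM_lookup, if_pos rfl])

theorem VarMap.Consistent.removeFromVM {m : VarMap b} (hm : m.Consistent H) (k : Name) :
    (removeFromVM H k m).1.Consistent H :=
  hm.of_change k (fun u hu => by rw [removeFromVM_lookup, if_neg hu])
    (by rw [removeFromVM_hash, removeFromVM_lookup, if_pos rfl, optEntryHash.eq_1, add_zero])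

theorem VarMap.Consistent.joinVM {m : VarMap b} (hm : m.Consistent H) (t : ℕ) (m' : VarMap b) :
    (joinVM H t m m').Consistent H := by
  unfold AlphaHash.joinVM
  induction m'.entries.entries with
  | nil => exact hm
  | cons kv l ih => exact VarMap.Consistent.alterVM ih (fun mp => mkPTJoin H t mp kv.2) kv.1

variable (H) in
/-- The value at a name of the join of two maps, in terms of its values there. -/
def optJoin (t : ℕ) : Option (PosTree b) → Option (PosTree b) → Option (PosTree b)
  | big, none => big
  | big, some p => some (mkPTJoin H t big p)

theorem foldr_alterVM_lookup (t : ℕ) (m : VarMap b) (l : List (Σ _ : Name, PosTree b))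
    (hl : l.NodupKeys) (u : Name) :
    (l.foldr (fun kv m => alterVM H (fun mp => mkPTJoin H t mp kv.2) kv.1 m) m).entries.lookup u =
      optJoin H t (m.entries.lookup u) (l.dlookup u) := by
  induction l with
  | nil => rfl
  | cons kv l ih =>
    obtain ⟨k, p⟩ := kv
    rw [List.nodupKeys_cons] at hl
    rw [List.foldr_cons, alterVM_lookup]
    split_ifs with hu
    · subst hu
      rw [ih hl.2, List.dlookup_cons_eq, List.dlookup_eq_none.2 hl.1]
      rfl
    · rw [ih hl.2, List.dlookup_cons_ne _ _ hu]

theorem joinVM_lookup (t : ℕ) (m m' : VarMap b) (u : Name) :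
    (joinVM H t m m').entries.lookup u =
      optJoin H t (m.entries.lookup u) (m'.entries.lookup u) :=
  foldr_alterVM_lookup t m m'.entries.entries m'.entries.nodupKeys u

theorem optJoin_map_eval (t : ℕ) (q p : Option PTree) :
    optJoin H t (q.map (PTree.eval H)) (p.map (PTree.eval H)) =
      (PTree.combine t q p).map (PTree.eval H) := by
  rcases q with _ | q <;> rcases p with _ | p <;> rfl

theorem length_entries_eq_card (m : VarMap b) {S : Finset Name}
    (hS : ∀ v, v ∈ S ↔ m.entries.lookup v ≠ none) : m.entries.entries.length = S.card := by
  have h : m.entries.keys.toFinset = S := by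
    ext v
    rw [List.mem_toFinset, hS, Ne, AList.lookup_eq_none, not_not, AList.mem_keys]
  rw [← h, List.toFinset_card_of_nodup m.entries.keys_nodup]
  simp [AList.keys, List.keys]

/-- The two claims need a joint induction: the structure of a λ uses a value of the map, and the map
of an application uses the depth of the structure as its tag. -/
theorem summariseExpr_lookup_and_str (e : Expression) :
    (∀ u, (summariseExpr H e).vm.entries.lookup u = (e.pos u).map (PTree.eval H)) ∧
      (summariseExpr H e).str = e.skeleton.eval H := by
  induction e with
  | var v =>
    refine ⟨fun u => ?_, rfl⟩
    simp only [summariseExpr, singletonVM, Expression.pos]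
    split_ifs with hu
    · subst hu
      exact List.dlookup_cons_eq _ _ _
    · exact List.dlookup_cons_ne _ _ hu
  | lam x e ih =>
    refine ⟨fun u => ?_, ?_⟩
    · simp only [summariseExpr, removeFromVM_lookup, Expression.pos, ih.1]
      split_ifs <;> rfl
    · simp only [summariseExpr, removeFromVM_snd, ih.1, ih.2, Expression.skeleton]
      cases e.pos x <;> rfl
  | app e₁ e₂ ih₁ ih₂ =>
    have hc : ∀ e : Expression, (∀ u, (summariseExpr H e).vm.entries.lookup u =
        (e.pos u).map (PTree.eval H)) →
        (summariseExpr H e).vm.entries.entries.length = e.free.card := fun e he =>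
      length_entries_eq_card _ fun v => by simp [he, Expression.mem_free]
    have hl : isBiggerThanVM (summariseExpr H e₁).vm (summariseExpr H e₂).vm =
        Expression.leftBigger e₁ e₂ := by
      rw [isBiggerThanVM, Expression.leftBigger, hc e₁ ih₁.1, hc e₂ ih₂.1]
    refine ⟨fun u => ?_, ?_⟩
    · simp only [summariseExpr, joinVM_lookup, structureTag, mkSApp, hl, Expression.pos, ih₁.2,
        ih₂.2, Skeleton.eval_depth, Expression.skeleton_depth, ← optJoin_map_eval]
      split_ifs <;> rw [ih₁.1, ih₂.1]
    · simp only [summariseExpr, hl, ih₁.2, ih₂.2, Expression.skeleton, Skeleton.eval]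

theorem summariseExpr_consistent (e : Expression) : (summariseExpr H e).vm.Consistent H := by
  induction e with
  | var v =>
    intro S hS
    have hv : (summariseExpr H (.var v)).vm.entries.lookup v = some (mkPTHere H) :=
      List.dlookup_cons_eq _ _ _
    rw [Finset.sum_eq_single_of_mem v (hS v (by simp [hv]))]
    · rw [hv]; rfl
    · intro u _ hu
      have : (summariseExpr H (.var v)).vm.entries.lookup u = none :=
        List.dlookup_cons_ne _ _ hu
      rw [this, optEntryHash]
  | lam x e ih => exact ih.removeFromVM x
  | app e₁ e₂ ih₁ ih₂ =>
    simp only [summariseExpr]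
    split_ifs
    · exact ih₁.joinVM _ _
    · exact ih₂.joinVM _ _

variable (H) in
def posHash (v : Name) (p : Option PTree) : HashCode b :=
  optEntryHash H v (p.map (PTree.eval H))

variable (H) in
def mapHash (e : Expression) : HashCode b := ∑ v ∈ e.free, posHash H v (e.pos v)

variable (H) in
theorem hashExpr_eq (e : Expression) :
    hashExpr H e = H.summary (e.skeleton.eval H).hash (mapHash H e) := by
  have h := summariseExpr_lookup_and_str (H := H) e
  rw [hashExpr, hashESummary, h.2, summariseExpr_consistent e e.free, mapHash]
  · simp only [h.1, posHash]
  · intro v hv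
    rw [h.1] at hv
    exact Expression.mem_free.2 fun hn => hv (by rw [hn]; rfl)

end Evaluation

/-! ### Independent uniform combiners -/

open MeasureTheory

/-- The arguments at which the combiners can be evaluated. -/
inductive Query (b : ℕ) where
  | sVar
  | sLam (size : ℕ) (p : Option (HashCode b)) (s : HashCode b)
  | sApp (size : ℕ) (leftBigger : Bool) (s₁ s₂ : HashCode b)
  | ptHere
  | ptJoin (size tag : ℕ) (big : Option (HashCode b)) (small : HashCode b)
  | entry (v : Name) (p : HashCode b)
  | summary (s m : HashCode b)

/-- The hashing functions that answer each query as prescribed by `ω`. -/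
def hashing {b : ℕ} (ω : Query b → HashCode b) : Hashing b where
  sVar := ω .sVar
  sLam n p s := ω (.sLam n p s)
  sApp n l s₁ s₂ := ω (.sApp n l s₁ s₂)
  ptHere := ω .ptHere
  ptJoin k t q p := ω (.ptJoin k t q p)
  entry v p := ω (.entry v p)
  summary s m := ω (.summary s m)

variable {b : ℕ}

/-- Countability allows an event to be split according to the value of a random query. -/
instance : Countable (Query b) := by
  let f : Query b → ℕ × ℕ × ℕ × Bool × Option (HashCode b) × HashCode b × HashCode b × List ℕ :=
    fun
      | .sVar => (0, 0, 0, false, none, 0, 0, [])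
      | .sLam n p s => (1, n, 0, false, p, s, 0, [])
      | .sApp n l s₁ s₂ => (2, n, 0, l, none, s₁, s₂, [])
      | .ptHere => (3, 0, 0, false, none, 0, 0, [])
      | .ptJoin k t q p => (4, k, t, false, q, p, 0, [])
      | .entry v p => (5, 0, 0, false, none, p, 0, v.toList.map Char.toNat)
      | .summary s m => (6, 0, 0, false, none, s, m, [])
  refine Function.Injective.countable (f := f) fun i j hij => ?_
  cases i <;> cases j <;> simp_all [f, String.toList_inj,
    (List.map_injective_iff.2 fun _ _ => Char.toNat_inj.1).eq_iff]

/-! ### Uniform answers and resampling -/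

instance : MeasurableSpace (Query b) := ⊤

instance : DiscreteMeasurableSpace (Query b) := ⟨fun _ => trivial⟩

instance : MeasurableAdd₂ (HashCode b) := ⟨Measurable.of_discrete⟩

/-- The uniform distribution on hash codes. -/
noncomputable def uniformCode (b : ℕ) : Measure (HashCode b) := ProbabilityTheory.uniformOn Set.univ

instance : IsProbabilityMeasure (uniformCode b) :=
  ProbabilityTheory.isProbabilityMeasure_uniformOn Set.finite_univ Set.univ_nonempty

theorem map_add_uniformCode (d : HashCode b) : (uniformCode b).map (· + d) = uniformCode b := by
  ext s hs
  rw [Measure.map_apply Measurable.of_discrete hs, uniformCode, ProbabilityTheory.uniformOn_univ,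
    ProbabilityTheory.uniformOn_univ]
  congr 1
  have h : s = (fun g => g + d) '' ((fun g => g + d) ⁻¹' s) :=
    (Set.image_preimage_eq s (add_right_surjective d)).symm
  conv_rhs => rw [h, Measure.count_injective_image (add_left_injective d)]

/-- All queries are answered independently and uniformly. -/
noncomputable def answerMeasure (b : ℕ) : Measure (Query b → HashCode b) :=
  Measure.infinitePi fun _ => uniformCode b

instance : IsProbabilityMeasure (answerMeasure b) := by
  unfold answerMeasure
  infer_instance

open Classical in
-- The map acts coordinatewise, as a translation at `i` and as the identity elsewhere, and the
-- uniform distribution is translation invariant.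
theorem measurePreserving_update_add (i : Query b) (d : HashCode b) :
    MeasurePreserving (fun ω => Function.update ω i (ω i + d)) (answerMeasure b)
      (answerMeasure b) := by
  have h : (fun ω : Query b → HashCode b => Function.update ω i (ω i + d)) =
      fun ω j => (fun g => if j = i then g + d else g) (ω j) := by
    ext ω j : 2
    by_cases hj : j = i
    · subst hj; simp
    · simp [hj]
  rw [h]
  refine ⟨measurable_pi_lambda _ fun j =>
    (Measurable.of_discrete (f := fun g => if j = i then g + d else g)).comp
      (measurable_pi_apply j), ?_⟩
  rw [answerMeasure, Measure.infinitePi_map_pi (μ := fun _ => uniformCode b)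
    (f := fun j g => if j = i then g + d else g) (fun j => Measurable.of_discrete)]
  congr 1
  ext j : 1
  by_cases hj : j = i
  · simp only [hj, if_true]
    exact map_add_uniformCode d
  · simp only [hj, if_false]
    exact Measure.map_id

theorem measurable_answer {A : (Query b → HashCode b) → Query b} (hA : Measurable A) :
    Measurable fun ω : Query b → HashCode b => ω (A ω) := by
  intro s hs
  have : (fun ω : Query b → HashCode b => ω (A ω)) ⁻¹' s =
      ⋃ i, A ⁻¹' {i} ∩ (fun ω => ω i) ⁻¹' s := by
    ext ω
    simp
  rw [this]
  exact .iUnion fun i => (hA (.of_discrete)).inter (measurable_pi_apply i hs)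

open Classical in
/-- If changing the answer to the query `A` leaves `E`, `A` and `B` unchanged, then on `E` that
answer is uniformly distributed relative to `B`. -/
theorem measure_answer_eq_le {A : (Query b → HashCode b) → Query b} (hA : Measurable A)
    {B : (Query b → HashCode b) → HashCode b} (hB : Measurable B)
    {E : Set (Query b → HashCode b)} (hE : MeasurableSet E)
    (h : ∀ ω ∈ E, ∀ c, Function.update ω (A ω) c ∈ E ∧ A (Function.update ω (A ω) c) = A ω ∧
      B (Function.update ω (A ω) c) = B ω) :
    answerMeasure b {ω | ω ∈ E ∧ ω (A ω) = B ω} ≤ (2 ^ b)⁻¹ := by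
  -- The `2 ^ b` sets `S d` are disjoint and none has smaller measure than `S 0`, so `S 0` has
  -- measure at most `2^-b`.
  let S : HashCode b → Set (Query b → HashCode b) := fun d => {ω | ω ∈ E ∧ ω (A ω) = B ω + d}
  have hS : ∀ d, MeasurableSet (S d) := fun d =>
    hE.inter (measurableSet_eq_fun (measurable_answer hA) (hB.add_const d))
  have hpart : ∀ d, answerMeasure b (S d) = ∑' i, answerMeasure b (S d ∩ A ⁻¹' {i}) := by
    intro d
    rw [← measure_iUnion]
    · congr 1
      ext ω
      simp
    · intro i j hij
      refine Set.disjoint_left.2 fun ω hi hj => hij ?_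
      exact (Set.mem_singleton_iff.1 hi.2).symm.trans hj.2
    · exact fun i => (hS d).inter (hA .of_discrete)
  -- On the cell `A ω = i` the query is fixed, so adding `d` to the answer at `i` preserves measure
  -- and carries `S 0` into `S d` within the cell.
  have hle : ∀ d, answerMeasure b (S 0) ≤ answerMeasure b (S d) := by
    intro d
    rw [hpart 0, hpart d]
    refine ENNReal.tsum_le_tsum fun i => ?_
    rw [← (measurePreserving_update_add i d).measure_preimage
      ((hS d).inter (hA .of_discrete)).nullMeasurableSet]
    refine measure_mono ?_
    rintro ω ⟨⟨hω, hω'⟩, rfl⟩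
    obtain ⟨h1, h2, h3⟩ := h ω hω (ω (A ω) + d)
    refine ⟨⟨h1, ?_⟩, h2⟩
    dsimp only
    rw [h2, h3, Function.update_self, hω', add_zero]
  have hsum : ∑ d, answerMeasure b (S d) ≤ 1 := by
    rw [← measure_biUnion_finset]
    · exact prob_le_one
    · intro d _ d' _ hd
      refine Set.disjoint_left.2 fun ω hi hj => hd ?_
      exact add_left_cancel (hi.2.symm.trans hj.2)
    · exact fun d _ => hS d
  have hcard : (2 ^ b : ENNReal) * answerMeasure b (S 0) ≤ 1 := by
    refine le_trans ?_ hsum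
    refine le_trans (le_of_eq ?_) (Finset.sum_le_sum fun d _ => hle d)
    simp [HashCode]
  have h0 : {ω | ω ∈ E ∧ ω (A ω) = B ω} = S 0 := by simp [S]
  rw [h0]
  exact ENNReal.le_inv_iff_mul_le.2 (by rwa [mul_comm])

/-! ### The order in which the queries are made -/

/-- Every query is made with answers to queries of smaller rank. -/
def Query.rank : Query b → ℕ ×ₗ ℕ
  | .ptHere => toLex (0, 1)
  | .ptJoin k _ _ _ => toLex (0, k)
  | .sVar => toLex (1, 1)
  | .sLam n _ _ => toLex (1, n)
  | .sApp n _ _ _ => toLex (1, n)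
  | .entry _ _ => toLex (2, 0)
  | .summary _ _ => toLex (3, 0)

/-- `X` is a random variable that depends only on the answers to queries of rank less than `r`. -/
structure DependsBelow {α : Type*} [MeasurableSpace α] (r : ℕ ×ₗ ℕ)
    (X : (Query b → HashCode b) → α) : Prop where
  measurable : Measurable X
  congr : ∀ ω ω' : Query b → HashCode b, (∀ j : Query b, j.rank < r → ω j = ω' j) → X ω = X ω'

namespace DependsBelow

variable {α β γ : Type*} [MeasurableSpace α] [MeasurableSpace β] [MeasurableSpace γ] {r r' : ℕ ×ₗ ℕ}

theorem const (a : α) : DependsBelow (b := b) r fun _ => a := ⟨measurable_const, fun _ _ _ => rfl⟩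

theorem comp [DiscreteMeasurableSpace α] {X : (Query b → HashCode b) → α} (hX : DependsBelow r X)
    (f : α → β) : DependsBelow r fun ω => f (X ω) :=
  ⟨Measurable.of_discrete.comp hX.measurable, fun ω ω' h => congrArg f (hX.congr ω ω' h)⟩

theorem comp₂ [DiscreteMeasurableSpace (α × β)] {X : (Query b → HashCode b) → α}
    {Y : (Query b → HashCode b) → β} (hX : DependsBelow r X) (hY : DependsBelow r Y)
    (f : α → β → γ) : DependsBelow r fun ω => f (X ω) (Y ω) :=
  ⟨(Measurable.of_discrete (f := fun p : α × β => f p.1 p.2)).comp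
    (hX.measurable.prodMk hY.measurable),
    fun ω ω' h => congrArg₂ f (hX.congr ω ω' h) (hY.congr ω ω' h)⟩

theorem mono {X : (Query b → HashCode b) → α} (hX : DependsBelow r X) (h : r ≤ r') :
    DependsBelow r' X :=
  ⟨hX.measurable, fun ω ω' hω => hX.congr ω ω' fun j hj => hω j (hj.trans_le h)⟩

theorem answer {A : (Query b → HashCode b) → Query b} (hA : DependsBelow r A)
    (hr : ∀ ω, (A ω).rank = r) (h : r < r') : DependsBelow r' fun ω : Query b → HashCode b => ω (A ω) :=
  ⟨measurable_answer hA.measurable, fun ω ω' hω => by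
    rw [← (hA.mono h.le).congr ω ω' hω]
    exact hω _ ((hr ω).trans_lt h)⟩

theorem sum {ι : Type*} (s : Finset ι) {X : ι → (Query b → HashCode b) → HashCode b}
    (hX : ∀ i, DependsBelow r (X i)) : DependsBelow r fun ω => ∑ i ∈ s, X i ω :=
  ⟨Finset.measurable_fun_sum s fun i _ => (hX i).measurable,
    fun ω ω' h => Finset.sum_congr rfl fun i _ => (hX i).congr ω ω' h⟩

open Classical in
theorem update {X : (Query b → HashCode b) → α} (hX : DependsBelow r X)
    (ω : Query b → HashCode b) {i : Query b} (hi : r ≤ i.rank) (c : HashCode b) :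
    X (Function.update ω i c) = X ω :=
  hX.congr _ _ fun j hj => by
    have hji : j ≠ i := fun h => (hj.trans_le hi).ne (congrArg Query.rank h)
    rw [Function.update_of_ne hji]

end DependsBelow

open Classical in
theorem measure_answer_collision_le {A A' : (Query b → HashCode b) → Query b} {r r' : ℕ ×ₗ ℕ}
    (hA : DependsBelow r A) (hr : ∀ ω, (A ω).rank = r) (hA' : DependsBelow r' A')
    (hr' : ∀ ω, (A' ω).rank = r') :
    answerMeasure b {ω | A ω ≠ A' ω ∧ ω (A ω) = ω (A' ω)} ≤ (2 ^ b)⁻¹ := by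
  -- Resample the answer of higher rank. Neither query depends on it, and since the queries differ,
  -- neither does the other answer; equal ranks do no harm.
  wlog h : r' ≤ r generalizing A A' r r'
  · convert this hA' hr' hA hr (le_of_not_ge h) using 3
    ext ω
    exact and_congr ne_comm eq_comm
  refine measure_answer_eq_le hA.measurable (measurable_answer hA'.measurable)
    (E := {ω | A ω ≠ A' ω})
    (measurableSet_eq_fun hA.measurable hA'.measurable).compl fun ω hω c => ?_
  have h1 := hA.update ω (hr ω).ge c
  have h2 := hA'.update ω (h.trans (hr ω).ge) c
  refine ⟨?_, h1, ?_⟩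
  · rw [Set.mem_ofPred_eq, h1, h2]
    exact hω
  · simp only [h2]
    exact Function.update_of_ne (Ne.symm hω) c ω

theorem measure_answer_collision_le_add {A A' : (Query b → HashCode b) → Query b} {r r' : ℕ ×ₗ ℕ}
    (hA : DependsBelow r A) (hr : ∀ ω, (A ω).rank = r) (hA' : DependsBelow r' A')
    (hr' : ∀ ω, (A' ω).rank = r') :
    answerMeasure b {ω | ω (A ω) = ω (A' ω)} ≤
      answerMeasure b {ω | A ω = A' ω} + (2 ^ b)⁻¹ := by
  refine le_trans (measure_mono ?_) ((measure_union_le _ _).trans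
    (add_le_add le_rfl (measure_answer_collision_le hA hr hA' hr')))
  intro ω hω
  exact (em (A ω = A' ω)).imp id fun h => ⟨h, hω⟩

/-! ### Collisions of position trees and of structures -/

/-- The query that computes the hash of a position tree. -/
def PTree.query (ω : Query b → HashCode b) : PTree → Query b
  | .here => .ptHere
  | .graft t p => .ptJoin (p.size + 1) t none (p.eval (hashing ω)).hash
  | .join t q p => .ptJoin (q.size + p.size + 1) t (some (q.eval (hashing ω)).hash)
      (p.eval (hashing ω)).hash

theorem PTree.eval_hash (ω : Query b → HashCode b) (p : PTree) :
    (p.eval (hashing ω)).hash = ω (p.query ω) := by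
  cases p <;> simp [eval, mkPTHere, mkPTJoin, query, eval_size, hashing]

theorem PTree.rank_query (p : PTree) (ω : Query b → HashCode b) :
    (p.query ω).rank = toLex (0, p.size) := by
  cases p <;> rfl

theorem lt_of_snd_lt {k m n : ℕ} (h : m < n) : (toLex (k, m) : ℕ ×ₗ ℕ) < toLex (k, n) :=
  Prod.Lex.toLex_lt_toLex.2 (Or.inr ⟨rfl, h⟩)

theorem lt_of_fst_lt {k l m n : ℕ} (h : k < l) : (toLex (k, m) : ℕ ×ₗ ℕ) < toLex (l, n) :=
  Prod.Lex.toLex_lt_toLex.2 (Or.inl h)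

theorem PTree.dependsBelow_query (p : PTree) :
    DependsBelow (b := b) (toLex (0, p.size)) fun ω => p.query ω := by
  have key : ∀ {p : PTree} {n : ℕ}, DependsBelow (b := b) (toLex (0, p.size)) (fun ω => p.query ω) →
      p.size < n → DependsBelow (b := b) (toLex (0, n)) fun ω => (p.eval (hashing ω)).hash :=
    fun {p n} hp hn => by
      simp only [eval_hash]
      exact hp.answer p.rank_query (lt_of_snd_lt hn)
  induction p with
  | here => exact .const _
  | graft t p ih => exact (key ih (Nat.lt_succ_self _)).comp fun g => Query.ptJoin (p.size + 1) t none g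
  | join t q p ihq ihp =>
    exact (key ihq (n := q.size + p.size + 1) (by omega)).comp₂
      (key ihp (n := q.size + p.size + 1) (by omega))
      fun g h => Query.ptJoin (q.size + p.size + 1) t (some g) h

theorem PTree.dependsBelow_hash (p : PTree) {r : ℕ ×ₗ ℕ} (hr : toLex (0, p.size) < r) :
    DependsBelow (b := b) r fun ω => (p.eval (hashing ω)).hash := by
  simp only [eval_hash]
  exact p.dependsBelow_query.answer p.rank_query hr

/-- Equal codes mean equal queries or a collision of distinct queries, the latter costing `2^-b`.
Equal queries of distinct trees require a collision between distinct corresponding children, so each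
node of `p` is charged at most once. -/
theorem PTree.measure_collision_le {p q : PTree} (hpq : p ≠ q) :
    answerMeasure b {ω | (p.eval (hashing ω)).hash = (q.eval (hashing ω)).hash} ≤
      p.size * (2 ^ b)⁻¹ := by
  have step : ∀ {p q : PTree} {n : ℕ}, p.size = n + 1 →
      answerMeasure b {ω | p.query ω = q.query ω} ≤ n * (2 ^ b)⁻¹ →
      answerMeasure b {ω | (p.eval (hashing ω)).hash = (q.eval (hashing ω)).hash} ≤
        p.size * (2 ^ b)⁻¹ := fun {p q n} hn h => by
    simp only [eval_hash]
    refine (measure_answer_collision_le_add p.dependsBelow_query p.rank_query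
      q.dependsBelow_query q.rank_query).trans ?_
    rw [hn, Nat.cast_add, Nat.cast_one, add_mul, one_mul]
    exact add_le_add h le_rfl
  induction p generalizing q with
  | here =>
    refine step (n := 0) rfl ?_
    cases q with
    | here => exact absurd rfl hpq
    | graft t' q => simp [query]
    | join t' q₁ q₂ => simp [query]
  | graft t p ih =>
    refine step (n := p.size) rfl ?_
    cases q with
    | here => simp [query]
    | graft t' q =>
      by_cases h : p = q
      · have ht : t ≠ t' := fun ht => hpq (by rw [h, ht])
        simp [query, ht]
      · refine le_trans (measure_mono fun ω hω => ?_) (ih h)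
        injection hω
    | join t' q₁ q₂ => simp [query]
  | join t p₁ p₂ ih₁ ih₂ =>
    refine step (n := p₁.size + p₂.size) rfl ?_
    cases q with
    | here => simp [query]
    | graft t' q => simp [query]
    | join t' q₁ q₂ =>
      rw [Nat.cast_add, add_mul]
      -- One differing pair of children suffices; if there is none, the tags differ and the queries
      -- are never equal.
      by_cases h₁ : p₁ = q₁
      · by_cases h₂ : p₂ = q₂
        · have ht : t ≠ t' := fun ht => hpq (by rw [h₁, h₂, ht])
          simp [query, ht]
        · refine le_trans (measure_mono fun ω hω => ?_) ((ih₂ h₂).trans le_add_self)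
          injection hω
      · refine le_trans (measure_mono fun ω hω => ?_) ((ih₁ h₁).trans le_self_add)
        injection hω with _ _ h _
        exact Option.some_injective _ h

namespace Skeleton

/-- The query that computes the hash of a structure. -/
def query (ω : Query b → HashCode b) : Skeleton → Query b
  | .var => .sVar
  | .lamUnused s => .sLam (s.size + 1) none (s.eval (hashing ω)).hash
  | .lamUsed p s => .sLam (s.size + 1) (some (p.eval (hashing ω)).hash) (s.eval (hashing ω)).hash
  | .app l s₁ s₂ => .sApp (s₁.size + s₂.size + 1) l (s₁.eval (hashing ω)).hash
      (s₂.eval (hashing ω)).hash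

theorem eval_hash (ω : Query b → HashCode b) (s : Skeleton) :
    (s.eval (hashing ω)).hash = ω (s.query ω) := by
  cases s <;> simp [eval, mkSVar, mkSLam, mkSApp, query, eval_size, hashing]

theorem rank_query (s : Skeleton) (ω : Query b → HashCode b) :
    (s.query ω).rank = toLex (1, s.size) := by
  cases s <;> rfl

theorem dependsBelow_query (s : Skeleton) :
    DependsBelow (b := b) (toLex (1, s.size)) fun ω => s.query ω := by
  have key : ∀ {s : Skeleton} {n : ℕ},
      DependsBelow (b := b) (toLex (1, s.size)) (fun ω => s.query ω) →
      s.size < n → DependsBelow (b := b) (toLex (1, n)) fun ω => (s.eval (hashing ω)).hash :=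
    fun {s n} hs hn => by
      simp only [eval_hash]
      exact hs.answer s.rank_query (lt_of_snd_lt hn)
  induction s with
  | var => exact .const _
  | lamUnused s ih => exact (key ih (Nat.lt_succ_self _)).comp fun g => Query.sLam (s.size + 1) none g
  | lamUsed p s ih =>
    exact (p.dependsBelow_hash (lt_of_fst_lt Nat.zero_lt_one)).comp₂ (key ih (Nat.lt_succ_self _))
      fun g h => Query.sLam (s.size + 1) (some g) h
  | app l s₁ s₂ ih₁ ih₂ =>
    exact (key ih₁ (n := s₁.size + s₂.size + 1) (by omega)).comp₂
      (key ih₂ (n := s₁.size + s₂.size + 1) (by omega))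
      fun g h => Query.sApp (s₁.size + s₂.size + 1) l g h

theorem dependsBelow_hash (s : Skeleton) {r : ℕ ×ₗ ℕ} (hr : toLex (1, s.size) < r) :
    DependsBelow (b := b) r fun ω => (s.eval (hashing ω)).hash := by
  simp only [eval_hash]
  exact s.dependsBelow_query.answer s.rank_query hr

/-- The greatest number of hashes that have to be compared to tell a structure from another one
by descending into one component at a time. -/
def weight : Skeleton → ℕ
  | .var => 1
  | .lamUnused s => s.weight + 1
  | .lamUsed p s => max p.size s.weight + 1
  | .app _ s₁ s₂ => max s₁.weight s₂.weight + 1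

/-- The scheme is that for position trees. Since only one differing component is followed, a maximum
replaces a sum in `weight`; charging the position trees of all binders could give a quadratic bound.
-/
theorem measure_collision_le {s t : Skeleton} (hst : s ≠ t) :
    answerMeasure b {ω | (s.eval (hashing ω)).hash = (t.eval (hashing ω)).hash} ≤
      s.weight * (2 ^ b)⁻¹ := by
  have step : ∀ {s t : Skeleton} {n : ℕ}, s.weight = n + 1 →
      answerMeasure b {ω | s.query ω = t.query ω} ≤ n * (2 ^ b)⁻¹ →
      answerMeasure b {ω | (s.eval (hashing ω)).hash = (t.eval (hashing ω)).hash} ≤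
        s.weight * (2 ^ b)⁻¹ := fun {s t n} hn h => by
    simp only [eval_hash]
    refine (measure_answer_collision_le_add s.dependsBelow_query s.rank_query
      t.dependsBelow_query t.rank_query).trans ?_
    rw [hn, Nat.cast_add, Nat.cast_one, add_mul, one_mul]
    exact add_le_add h le_rfl
  have mono : ∀ {m n : ℕ}, m ≤ n → (m : ENNReal) * (2 ^ b)⁻¹ ≤ n * (2 ^ b)⁻¹ := fun h =>
    mul_le_mul_left (Nat.cast_le.2 h) _
  induction s generalizing t with
  | var =>
    refine step (n := 0) rfl ?_
    cases t with
    | var => exact absurd rfl hst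
    | _ => simp [query]
  | lamUnused s ih =>
    refine step (n := s.weight) rfl ?_
    cases t with
    | lamUnused t =>
      have h : s ≠ t := fun h => hst (by rw [h])
      refine le_trans (measure_mono fun ω hω => ?_) (ih h)
      injection hω
    | _ => simp [query]
  | lamUsed p s ih =>
    refine step (n := max p.size s.weight) rfl ?_
    cases t with
    | lamUsed q t =>
      by_cases hpq : p = q
      · have h : s ≠ t := fun h => hst (by rw [hpq, h])
        refine le_trans (measure_mono fun ω hω => ?_) ((ih h).trans (mono (le_max_right _ _)))
        injection hω
      · refine le_trans (measure_mono fun ω hω => ?_)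
          ((PTree.measure_collision_le hpq).trans (mono (le_max_left _ _)))
        injection hω with _ h _
        exact Option.some_injective _ h
    | _ => simp [query]
  | app l s₁ s₂ ih₁ ih₂ =>
    refine step (n := max s₁.weight s₂.weight) rfl ?_
    cases t with
    | app l' t₁ t₂ =>
      by_cases h₁ : s₁ = t₁
      · by_cases h₂ : s₂ = t₂
        · have hl : l ≠ l' := fun hl => hst (by rw [h₁, h₂, hl])
          simp [query, hl]
        · refine le_trans (measure_mono fun ω hω => ?_) ((ih₂ h₂).trans (mono (le_max_right _ _)))
          injection hω
      · refine le_trans (measure_mono fun ω hω => ?_) ((ih₁ h₁).trans (mono (le_max_left _ _)))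
        injection hω
    | _ => simp [query]

end Skeleton

theorem Expression.weight_skeleton_le (e : Expression) : e.skeleton.weight ≤ e.size := by
  induction e with
  | var v => exact le_rfl
  | lam x e ih =>
    rw [skeleton, size]
    cases h : e.pos x with
    | none => exact Nat.succ_le_succ ih
    | some p => exact Nat.succ_le_succ (max_le (pos_size_le h) ih)
  | app e₁ e₂ ih₁ ih₂ =>
    simp only [skeleton, size, Skeleton.weight]
    omega

/-! ### Collisions of variable maps -/

theorem posHash_hashing_some (ω : Query b → HashCode b) (v : Name) (p : PTree) :
    posHash (hashing ω) v (some p) = ω (.entry v (p.eval (hashing ω)).hash) := rfl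

theorem PTree.dependsBelow_entry (v : Name) (p : PTree) :
    DependsBelow (b := b) (toLex (2, 0)) fun ω => Query.entry v (p.eval (hashing ω)).hash :=
  (p.dependsBelow_hash (lt_of_fst_lt Nat.zero_lt_two)).comp _

theorem dependsBelow_posHash (v : Name) (o : Option PTree) :
    DependsBelow (b := b) (toLex (3, 0)) fun ω => posHash (hashing ω) v o := by
  cases o with
  | none => exact .const 0
  | some p =>
    exact (p.dependsBelow_entry v).answer (fun _ => rfl) (lt_of_fst_lt (Nat.lt_succ_self 2))

theorem dependsBelow_mapHash (e : Expression) :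
    DependsBelow (b := b) (toLex (3, 0)) fun ω => mapHash (hashing ω) e :=
  .sum _ fun v => dependsBelow_posHash v (e.pos v)

open Classical in
-- Position tree hashes rank below entry queries, so resampling an entry affects only contributions
-- that make exactly that query.
theorem posHash_update {ω : Query b → HashCode b} {v : Name} {g : HashCode b} (c : HashCode b)
    {u : Name} {o : Option PTree}
    (h : ∀ q, o = some q → u = v → (q.eval (hashing ω)).hash ≠ g) :
    posHash (hashing (Function.update ω (.entry v g) c)) u o = posHash (hashing ω) u o := by
  cases o with
  | none => rfl
  | some q =>
    rw [posHash_hashing_some, posHash_hashing_some, (q.dependsBelow_hash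
      (lt_of_fst_lt (n := 0) Nat.zero_lt_two)).update ω (i := .entry v g) le_rfl c]
    have hne : Query.entry u (q.eval (hashing ω)).hash ≠ .entry v g := fun heq => by
      injection heq with h1 h2
      exact h q rfl h1 h2
    rw [Function.update_of_ne hne]

/-- Outside the event `C` that `p` collides with the tree at `v` in the other map, the entry query
for `v` and `p` occurs once in the two XORs together. Its answer is then uniform relative to all
other terms. The event `C` costs the size of `p`, at most `e₁.size`, and the fresh answer costs 1.
-/
theorem measure_mapHash_collision_le_of_some {e₁ e₂ : Expression} {v : Name} {p : PTree}
    (h₁ : e₁.pos v = some p) (h₂ : e₂.pos v ≠ some p) :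
    answerMeasure b {ω | mapHash (hashing ω) e₁ = mapHash (hashing ω) e₂} ≤
      (e₁.size + 1) * (2 ^ b)⁻¹ := by
  classical
  let C : Set (Query b → HashCode b) :=
    {ω | ∃ q, e₂.pos v = some q ∧ (p.eval (hashing ω)).hash = (q.eval (hashing ω)).hash}
  have hC : MeasurableSet C ∧ answerMeasure b C ≤ e₁.size * (2 ^ b)⁻¹ := by
    cases h : e₂.pos v with
    | none =>
      have : C = ∅ := by simp [C, h]
      rw [this]
      exact ⟨.empty, by simp⟩
    | some q =>
      have : C = {ω | (p.eval (hashing ω)).hash = (q.eval (hashing ω)).hash} := by simp [C, h]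
      rw [this]
      refine ⟨measurableSet_eq_fun (p.dependsBelow_hash (lt_of_fst_lt (n := 0) zero_lt_two)).measurable
        (q.dependsBelow_hash (lt_of_fst_lt (n := 0) zero_lt_two)).measurable, ?_⟩
      refine (PTree.measure_collision_le fun hpq => h₂ (by rw [h, hpq])).trans ?_
      exact mul_le_mul_left (Nat.cast_le.2 (Expression.pos_size_le h₁)) _
  let A : (Query b → HashCode b) → Query b := fun ω => Query.entry v (p.eval (hashing ω)).hash
  let B : (Query b → HashCode b) → HashCode b := fun ω =>
    ∑ u ∈ e₁.free.erase v, posHash (hashing ω) u (e₁.pos u) + mapHash (hashing ω) e₂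
  have hA := p.dependsBelow_entry (b := b) v
  have hB : DependsBelow (toLex (3, 0)) B :=
    (DependsBelow.sum _ fun u => dependsBelow_posHash u (e₁.pos u)).comp₂
      (dependsBelow_mapHash e₂) (· + ·)
  have hfresh : answerMeasure b {ω | ω ∈ Cᶜ ∧ ω (A ω) = B ω} ≤ (2 ^ b)⁻¹ := by
    refine measure_answer_eq_le hA.measurable hB.measurable hC.1.compl fun ω hω c => ?_
    have hash_update : ∀ q : PTree,
        (q.eval (hashing (Function.update ω (A ω) c))).hash = (q.eval (hashing ω)).hash := fun q =>
      (q.dependsBelow_hash (lt_of_fst_lt (n := 0) Nat.zero_lt_two)).update ω (i := A ω) le_rfl c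
    refine ⟨fun ⟨q, hq, hpq⟩ => hω ⟨q, hq, ?_⟩, hA.update ω (i := A ω) le_rfl c, ?_⟩
    · rwa [hash_update, hash_update] at hpq
    · refine congrArg₂ (· + ·) (Finset.sum_congr rfl fun u hu => ?_)
        (Finset.sum_congr rfl fun u _ => ?_)
      · exact posHash_update c fun q _ huv => absurd huv (Finset.ne_of_mem_erase hu)
      -- An entry of the second map making the same query would put `ω` in `C`.
      · refine posHash_update c fun q hq huv hpq => hω ⟨q, ?_, hpq.symm⟩
        rw [← huv, hq]
  rw [add_mul, one_mul]
  refine le_trans (measure_mono fun ω hω => ?_)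
    ((measure_union_le C _).trans (add_le_add hC.2 hfresh))
  refine (em (ω ∈ C)).imp id fun hωC => ⟨hωC, ?_⟩
  have hv : v ∈ e₁.free := Expression.mem_free.2 (by simp [h₁])
  have hsum : mapHash (hashing ω) e₁ =
      ω (A ω) + ∑ u ∈ e₁.free.erase v, posHash (hashing ω) u (e₁.pos u) := by
    rw [mapHash, ← Finset.add_sum_erase _ _ hv, h₁, posHash_hashing_some]
  have hω' : mapHash (hashing ω) e₁ = mapHash (hashing ω) e₂ := hω
  simp only [B]
  -- XOR is its own inverse, so equality of the map hashes can be solved for the fresh answer.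
  rw [← hω', hsum, add_left_comm, HashCode.add_self, add_zero]

theorem measure_mapHash_collision_le {e₁ e₂ : Expression} (h : e₁.pos ≠ e₂.pos) :
    answerMeasure b {ω | mapHash (hashing ω) e₁ = mapHash (hashing ω) e₂} ≤
      (e₁.size + e₂.size + 1) * (2 ^ b)⁻¹ := by
  obtain ⟨v, hv⟩ := Function.ne_iff.1 h
  cases h₁ : e₁.pos v with
  | some p =>
    refine (measure_mapHash_collision_le_of_some h₁ (by rw [← h₁]; exact hv.symm)).trans ?_
    gcongr
    exact le_self_add
  | none =>
    obtain ⟨p, h₂⟩ := Option.ne_none_iff_exists'.1 (h₁ ▸ hv.symm)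
    have := measure_mapHash_collision_le_of_some (b := b) h₂ (by rw [← h₂]; exact hv)
    simp only [eq_comm (a := mapHash _ e₂)] at this
    refine this.trans ?_
    gcongr
    exact le_add_self

/-! ### Collisions of expressions -/

/-- The query that computes the hash of an expression. -/
def Expression.query (ω : Query b → HashCode b) (e : Expression) : Query b :=
  .summary (e.skeleton.eval (hashing ω)).hash (mapHash (hashing ω) e)

theorem hashExpr_hashing (ω : Query b → HashCode b) (e : Expression) :
    hashExpr (hashing ω) e = ω (e.query ω) :=
  hashExpr_eq (hashing ω) e

theorem Expression.dependsBelow_query (e : Expression) :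
    DependsBelow (b := b) (toLex (3, 0)) fun ω => e.query ω :=
  (e.skeleton.dependsBelow_hash (lt_of_fst_lt (by norm_num))).comp₂ (dependsBelow_mapHash e)
    fun g h => Query.summary g h

theorem measurable_hashExpr (e : Expression) :
    Measurable fun ω : Query b → HashCode b => hashExpr (hashing ω) e := by
  simp only [hashExpr_hashing]
  exact measurable_answer e.dependsBelow_query.measurable

theorem Expression.size_pos (e : Expression) : 0 < e.size := by
  cases e <;> simp [size]

theorem measure_hashExpr_collision_le {e₁ e₂ : Expression} (h : ¬ AlphaEquiv e₁ e₂) :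
    answerMeasure b {ω | hashExpr (hashing ω) e₁ = hashExpr (hashing ω) e₂} ≤
      (e₁.size + e₂.size + 2) * (2 ^ b)⁻¹ := by
  simp only [hashExpr_hashing]
  refine (measure_answer_collision_le_add e₁.dependsBelow_query (fun _ => rfl)
    e₂.dependsBelow_query (fun _ => rfl)).trans ?_
  have h2 : ((e₁.size : ENNReal) + e₂.size + 2) * (2 ^ b)⁻¹ =
      (e₁.size + e₂.size + 1) * (2 ^ b)⁻¹ + (2 ^ b)⁻¹ := by
    rw [← one_add_one_eq_two, ← add_assoc, add_mul _ 1, one_mul]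
  rw [h2]
  refine add_le_add ?_ le_rfl
  -- Equal final queries make both the skeleton hashes and the map hashes collide; it suffices to
  -- bound whichever comes from distinct symbolic data.
  by_cases hs : e₁.skeleton = e₂.skeleton
  · refine le_trans (measure_mono fun ω hω => ?_)
      (measure_mapHash_collision_le fun hm => h (alphaEquiv_of_skeleton_eq hs hm))
    injection hω
  · refine le_trans (measure_mono fun ω hω => ?_)
      ((Skeleton.measure_collision_le hs).trans ?_)
    · injection hω
    · gcongr
      refine (Nat.cast_le.2 e₁.weight_skeleton_le).trans ?_
      rw [add_assoc]
      exact le_self_add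

end AlphaHash

open AlphaHash in
theorem mainTheorem1 (b : ℕ) (hb : 0 < b) :
    ∃ (Ω : Type) (_ : MeasurableSpace Ω) (P : MeasureTheory.Measure Ω)
      (_ : MeasureTheory.IsProbabilityMeasure P) (H : Ω → AlphaHash.Hashing b),
      (∀ e : AlphaHash.Expression, Measurable fun ω => AlphaHash.hashExpr (H ω) e) ∧
      ∀ e₁ e₂ : AlphaHash.Expression, ¬ AlphaHash.AlphaEquiv e₁ e₂ →
        P.real {ω | AlphaHash.hashESummary (H ω) (AlphaHash.summariseExpr (H ω) e₁) =
            AlphaHash.hashESummary (H ω) (AlphaHash.summariseExpr (H ω) e₂)} ≤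
          5 * ((e₁.size : ℝ) + (e₂.size : ℝ)) / 2 ^ b := by
  refine ⟨Query b → HashCode b, inferInstance, answerMeasure b, inferInstance, hashing,
    measurable_hashExpr, fun e₁ e₂ h => ?_⟩
  have hle := ENNReal.toReal_mono (by finiteness) (measure_hashExpr_collision_le (b := b) h)
  refine hle.trans ?_
  have h₁ : (1 : ℝ) ≤ e₁.size := Nat.one_le_cast.2 e₁.size_pos
  have h₂ : (1 : ℝ) ≤ e₂.size := Nat.one_le_cast.2 e₂.size_pos
  have hreal : (((e₁.size : ENNReal) + e₂.size + 2) * (2 ^ b)⁻¹).toReal =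
      ((e₁.size : ℝ) + e₂.size + 2) / 2 ^ b := by
    rw [ENNReal.toReal_mul, ENNReal.toReal_add (by finiteness) (by finiteness),
      ENNReal.toReal_add (by finiteness) (by finiteness)]
    simp [div_eq_mul_inv]
  rw [hreal]
  gcongr
  -- Sizes are at least 1, so the additive 2 is at most `|e₁| + |e₂|`; the factor 2 would already
  -- suffice.
  linarith
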